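/- Work over $\mathbb{C}$. Let $X\subset\mathbb{P}^r$ be an irreducible, non-degenerate projective variety of dimension $m$ (non-degenerate: its linear span is $\mathbb{P}^r$). For a smooth point $P$ of $X$ let $T_{X,P}$ be the embedded tangent space to $X$ at $P$. A hyperplane $H$ is tangent to $X$ at a smooth point $P$ if $T_{X,P}\subset H$. For an integer $k\ge 0$ with $km+m+k<r$ (so that the closure of the union of the $k$-spaces spanned by $k+1$ independent points of $X$ is not $\mathbb{P}^r$), $X$ is called $k$-weakly defective if, for general points $P_0,\dots,P_k\in X$, the general hyperplane $H$ containing $T_{X,P_0},\dots,T_{X,P_k}$ has a contact variety of positive dimension, that is, $H$ is tangent to $X$ along a positive-dimensional irreducible closed subvariety $Z\subset X$ passing through one of the points $P_i$ (meaning that $H$ is tangent to $X$ at every point of $Z$ that is smooth on $X$). Let $k\ge 1$ be an integer with $km+m+k<r$, and assume that $X$ is not $k$-weakly defective. Then $X$ is not $(k-1)$-weakly defective. Consequently, $X$ is not $j$-weakly defective for any integer $0\le j\le k$. -/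

import Mathlib

open scoped LinearAlgebra.Projectivization

namespace WeakDefect

/-- The complex projective space of dimension `r`. -/
abbrev PSpace (r : ℕ) : Type := ℙ ℂ (Fin (r + 1) → ℂ)

/-- The common zeros in projective space of a set of (homogeneous) polynomials. -/
def zeroSet {r : ℕ} (S : Set (MvPolynomial (Fin (r + 1)) ℂ)) : Set (PSpace r) :=
  {P | ∀ f ∈ S, MvPolynomial.eval P.rep f = 0}

/-- Algebraic subsets: zero sets of families of homogeneous polynomials. -/
def algebraicSets (r : ℕ) : Set (Set (PSpace r)) :=
  {Z | ∃ S : Set (MvPolynomial (Fin (r + 1)) ℂ),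
    (∀ f ∈ S, ∃ d : ℕ, f.IsHomogeneous d) ∧ Z = zeroSet S}

/-- The Zariski topology on projective space. -/
instance zariski (r : ℕ) : TopologicalSpace (PSpace r) :=
  TopologicalSpace.ofClosed (algebraicSets r)
    (by
      refine ⟨{1}, ?_, ?_⟩
      · rintro f rfl
        exact ⟨0, MvPolynomial.isHomogeneous_one _ _⟩
      · ext P
        simp [zeroSet])
    (by
      intro A hA
      have hA' : ∀ Z, ∃ S : Set (MvPolynomial (Fin (r + 1)) ℂ), Z ∈ A →
          (∀ f ∈ S, ∃ d : ℕ, f.IsHomogeneous d) ∧ Z = zeroSet S := by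
        intro Z
        by_cases hZ : Z ∈ A
        · obtain ⟨S, hS⟩ := hA hZ
          exact ⟨S, fun _ => hS⟩
        · exact ⟨∅, fun h => absurd h hZ⟩
      choose S hS using hA'
      refine ⟨⋃ Z ∈ A, S Z, ?_, ?_⟩
      · intro f hf
        simp only [Set.mem_iUnion] at hf
        obtain ⟨Z, hZ, hf⟩ := hf
        exact (hS Z hZ).1 f hf
      · ext P
        simp only [Set.mem_sInter, zeroSet, Set.mem_iUnion, Set.mem_ofPred_eq]
        constructor
        · rintro h f ⟨Z, hZ, hf⟩
          have h1 := h Z hZ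
          rw [(hS Z hZ).2] at h1
          exact h1 f hf
        · intro h Z hZ
          rw [(hS Z hZ).2]
          exact fun f hf => h f ⟨Z, hZ, hf⟩)
    (by
      rintro _ ⟨S, hS, rfl⟩ _ ⟨T, hT, rfl⟩
      refine ⟨{p | ∃ f ∈ S, ∃ g ∈ T, p = f * g}, ?_, ?_⟩
      · rintro _ ⟨f, hf, g, hg, rfl⟩
        obtain ⟨d, hd⟩ := hS f hf
        obtain ⟨e, he⟩ := hT g hg
        exact ⟨d + e, hd.mul he⟩
      · ext P
        constructor
        · rintro (h | h) _ ⟨f, hf, g, hg, rfl⟩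
          · rw [map_mul, h f hf, zero_mul]
          · rw [map_mul, h g hg, mul_zero]
        · intro h
          by_contra hc
          simp only [Set.mem_union, not_or, zeroSet, Set.mem_ofPred_eq, not_forall] at hc
          obtain ⟨⟨f, hf, hf0⟩, ⟨g, hg, hg0⟩⟩ := hc
          have h1 := h (f * g) ⟨f, hf, g, hg, rfl⟩
          rw [map_mul] at h1
          exact (mul_ne_zero hf0 hg0) h1)

/-- Polynomials in `n` groups of `r + 1` variables that are homogeneous, of degree `d i`, in the
`i`-th group of variables for every `i`. -/
def IsMultihomogeneous {n r : ℕ} (f : MvPolynomial (Fin n × Fin (r + 1)) ℂ)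
    (d : Fin n → ℕ) : Prop :=
  MvPolynomial.IsWeightedHomogeneous
    (fun ij : Fin n × Fin (r + 1) => (Pi.single ij.1 1 : Fin n → ℕ)) f d

/-- Zariski open subsets of the product of `n` copies of projective space: complements of zero sets
of families of multihomogeneous polynomials. -/
def IsZariskiOpen {n r : ℕ} (U : Set (Fin n → PSpace r)) : Prop :=
  ∃ S : Set (MvPolynomial (Fin n × Fin (r + 1)) ℂ),
    (∀ f ∈ S, ∃ d : Fin n → ℕ, IsMultihomogeneous f d) ∧
    U = {P | ∃ f ∈ S, MvPolynomial.eval (fun ij => (P ij.1).rep ij.2) f ≠ 0}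

/-- The linear span of a subset of projective space, as a vector subspace of `ℂ ^ (r + 1)`. -/
noncomputable def linearSpan {r : ℕ} (Y : Set (PSpace r)) : Submodule ℂ (Fin (r + 1) → ℂ) :=
  ⨆ P ∈ Y, P.submodule

/-- An irreducible, non-degenerate projective variety of dimension `m` in projective space of
dimension `r`. -/
structure IsNondegenerateVariety {r : ℕ} (X : Set (PSpace r)) (m : ℕ) : Prop where
  isClosed : IsClosed X
  isIrreducible : IsIrreducible X
  dim_eq : topologicalKrullDim X = m
  span_eq : linearSpan X = ⊤

/-- The embedded tangent space to `X` at `P`, as a vector subspace of `ℂ ^ (r + 1)`: the common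
kernel of the differentials at `P` of the homogeneous polynomials vanishing on `X`. -/
noncomputable def tangentSpace {r : ℕ} (X : Set (PSpace r)) (P : PSpace r) :
    Submodule ℂ (Fin (r + 1) → ℂ) where
  carrier := {v | ∀ f : MvPolynomial (Fin (r + 1)) ℂ, (∃ d : ℕ, f.IsHomogeneous d) →
    (∀ Q ∈ X, MvPolynomial.eval Q.rep f = 0) →
    ∑ j, MvPolynomial.eval P.rep (MvPolynomial.pderiv j f) * v j = 0}
  add_mem' := by
    intro v w hv hw f hf hX
    simp only [Pi.add_apply, mul_add, Finset.sum_add_distrib]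
    rw [hv f hf hX, hw f hf hX, add_zero]
  zero_mem' := by
    intro f _ _
    simp
  smul_mem' := by
    intro c v hv f hf hX
    simp only [Pi.smul_apply, smul_eq_mul, mul_left_comm _ c, ← Finset.mul_sum]
    rw [hv f hf hX, mul_zero]

/-- The smooth points of an irreducible variety `X`: those where the (projective) dimension of the
embedded tangent space is the dimension of `X`. -/
def smoothLocus {r : ℕ} (X : Set (PSpace r)) : Set (PSpace r) :=
  {P | P ∈ X ∧
    ((Module.finrank ℂ (tangentSpace X P) : ℕ) : WithBot ℕ∞) = topologicalKrullDim X + 1}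

/-- The span of the tangent spaces to `X` at the points `P i`. -/
noncomputable def tangentSpan {r n : ℕ} (X : Set (PSpace r)) (P : Fin n → PSpace r) :
    Submodule ℂ (Fin (r + 1) → ℂ) :=
  ⨆ i, tangentSpace X (P i)

/-- The hyperplane with coordinates `h` in the dual projective space. -/
noncomputable def hyperplane {r : ℕ} (h : PSpace r) : Submodule ℂ (Fin (r + 1) → ℂ) where
  carrier := {v | ∑ j, h.rep j * v j = 0}
  add_mem' := by
    intro v w hv hw
    simp only [Set.mem_ofPred_eq] at hv hw
    simp [mul_add, Finset.sum_add_distrib, hv, hw]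
  zero_mem' := by simp
  smul_mem' := by
    intro c v hv
    simp only [Set.mem_ofPred_eq] at hv
    simp [mul_left_comm _ c, ← Finset.mul_sum, hv]

/-- The contact variety of the hyperplane `h` at the points `P i` has positive dimension: `h` is
tangent to `X` along an irreducible closed subvariety `Z` of positive dimension that passes through
one of the points `P i` (tangency being required at the points of `Z` that are smooth on `X`). -/
def HasPositiveDimContact {r n : ℕ} (X : Set (PSpace r)) (P : Fin n → PSpace r)
    (h : PSpace r) : Prop :=
  ∃ Z : Set (PSpace r), IsClosed Z ∧ IsIrreducible Z ∧ Z ⊆ X ∧ (∃ i, P i ∈ Z) ∧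
    0 < topologicalKrullDim Z ∧
    ∀ Q ∈ Z, Q ∈ smoothLocus X → tangentSpace X Q ≤ hyperplane h

/-- `X` is `k`-weakly defective: for `k + 1` general points of `X` (a nonempty Zariski open set of
`(k + 1)`-tuples of smooth points), the general hyperplane containing the tangent spaces to `X` at
these points (a nonempty Zariski open set of the linear system of such hyperplanes) has a contact
variety of positive dimension. The notion is meant for those `k` for which the `k`-secant variety
is not the whole space, e.g. if `k * m + m + k < r` with `m` the dimension of `X`. -/
def IsWeaklyDefective {r : ℕ} (X : Set (PSpace r)) (k : ℕ) : Prop :=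
  ∃ U : Set (Fin (k + 1) → PSpace r), IsZariskiOpen U ∧
    (∃ P ∈ U, ∀ i, P i ∈ smoothLocus X) ∧
    ∀ P ∈ U, (∀ i, P i ∈ smoothLocus X) →
      ∃ V : Set (PSpace r), IsOpen V ∧
        (∃ h ∈ V, tangentSpan X P ≤ hyperplane h) ∧
        ∀ h ∈ V, tangentSpan X P ≤ hyperplane h → HasPositiveDimContact X P h

end WeakDefect

/-! It suffices that weak defectivity passes from `k` to `k + 1` while `(k + 1) * m + m + (k + 1) <
r`. A hyperplane tangent at `k + 2` points is tangent at the first `k + 1`, but it is special among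
those, so defectivity for the general one does not apply directly. The remedy is semicontinuity
(`hasPositiveDimContact_of_open`): if general hyperplanes tangent at given smooth points have
positive-dimensional contact there, then all of them do.

To see this, join the given hyperplane to a general one by a pencil with parameter `t`. Infinitely
many members have contact through one fixed `P i`. The contact locus near `P i` is cut out by the
equations of `X` and by minors that are linear in `t`. If the point were isolated in the fibre `t =
0`, Krull's principal ideal theorem would make the constant family a component of the total locus,
and the point would be isolated for all but finitely many `t` (`exists_prime_lt_of_infinite`).

The minors detect tangency only at smooth points, so smoothness must be open; this rests on
`finrank_tangentSpace_ge`. The numerical hypothesis serves to produce a hyperplane tangent at all `k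
+ 2` points. -/

namespace WeakDefect

/-! ### Commutative algebra: isolated primes in families, heights of maximal ideals. -/

section CommutativeAlgebra

/-- After localizing at `p`, the only prime over `J` is the maximal ideal, so `x` is nilpotent
modulo `J`; the factor `y` clears the denominator. -/
theorem exists_pow_mul_mem_of_mem_minimalPrimes {R : Type*} [CommRing R] {J p : Ideal R}
    (hp : p ∈ J.minimalPrimes) {x : R} (hx : x ∈ p) : ∃ y ∉ p, ∃ n : ℕ, x ^ n * y ∈ J := by
  have hpp : p.IsPrime := hp.isPrime
  by_contra! hc
  let N : Submonoid R := Submonoid.powers x ⊔ p.primeCompl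
  have hdisj : Disjoint (J : Set R) N := by
    rw [Set.disjoint_left]
    intro z hz hzN
    obtain ⟨_, ⟨n, rfl⟩, y, hy, rfl⟩ := Submonoid.mem_sup.1 hzN
    exact hc y hy n hz
  obtain ⟨q, hq, hJq, hqN⟩ := Ideal.exists_le_prime_disjoint J N hdisj
  rw [Set.disjoint_left] at hqN
  have hqp : q ≤ p := by
    intro z hz
    by_contra hzp
    exact hqN hz ((le_sup_right : p.primeCompl ≤ N) hzp)
  exact hqN (hp.2 ⟨hq, hJq⟩ hqp hx)
    ((le_sup_left : Submonoid.powers x ≤ N) (Submonoid.mem_powers x))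

open Polynomial in
/-- Semicontinuity of isolatedness: if a prime `p` fails to be isolated in the fibres over
infinitely many values of the parameter, then it fails to be isolated in the fibre over `0`. -/
theorem exists_prime_lt_of_infinite {k R : Type*} [Field k] [CommRing R] [IsNoetherianRing R]
    [Algebra k R] (p : Ideal R) [p.IsPrime] (J : Ideal R[X]) (hJ : J ≤ p.map C) (T : Set k)
    (hT : T.Infinite)
    (h : ∀ t ∈ T, ∃ q : Ideal R, q.IsPrime ∧ q < p ∧
      ∀ f ∈ J, f.eval (algebraMap k R t) ∈ q) :
    ∃ q : Ideal R, q.IsPrime ∧ q < p ∧ ∀ f ∈ J, f.eval 0 ∈ q := by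
  classical
  by_contra hc
  push Not at hc
  have hprime : (p.map (C : R →+* R[X])).IsPrime := inferInstance
  let M : Ideal R[X] := p.comap (evalRingHom (0 : R))
  have hMp : M.IsPrime := Ideal.comap_isPrime _ _
  have hpM : p.map C ≤ M := by
    rw [Ideal.map_le_iff_le_comap]
    intro a ha
    simpa [M] using ha
  have hXM : (X : R[X]) ∈ M := by simp [M]
  have hXp : (X : R[X]) ∉ p.map C := by
    intro hX
    have := (Ideal.mem_map_C_iff.1 hX) 1
    rw [coeff_X_one] at this
    exact (Ideal.IsPrime.ne_top ‹_›) ((Ideal.eq_top_iff_one _).2 this)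
  have hlt : p.map C < M := lt_of_le_of_ne hpM (fun e => hXp (e ▸ hXM))
  have hdecomp : ∀ q : Ideal R[X], X ∈ q → ∀ f : R[X], f ∈ q ↔ C (f.eval 0) ∈ q := by
    intro q hq f
    have : f = X * f.divX + C (f.eval 0) := by
      conv_lhs => rw [← X_mul_divX_add f]
      rw [coeff_zero_eq_eval_zero]
    constructor
    · intro hf
      have h2 : C (f.eval 0) = f - X * f.divX := by
        rw [eq_sub_iff_add_eq, add_comm]; exact this.symm
      rw [h2]
      exact q.sub_mem hf (q.mul_mem_right _ hq)
    · intro hf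
      rw [this]
      exact q.add_mem (q.mul_mem_right _ hq) hf
  -- A prime containing `X` is determined by its contraction to `R`, so minimality of `M = p + (X)`
  -- over `J + (X)` is exactly isolatedness of `p` in the fibre over `0`.
  have hmin : M ∈ (Ideal.span (insert X (J : Set R[X]))).minimalPrimes := by
    refine ⟨⟨hMp, ?_⟩, ?_⟩
    · rw [Ideal.span_le]
      rintro f (rfl | hf)
      · exact hXM
      · exact hpM (hJ hf)
    · rintro q ⟨hq, hJq⟩ hqM
      rw [Ideal.span_le] at hJq
      have hXq : X ∈ q := hJq (Set.mem_insert _ _)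
      have hle : q.comap C ≤ p := by
        intro a ha
        have := hqM ha
        simpa [M] using this
      have heq : q.comap C = p := by
        by_contra hne
        obtain ⟨f, hf, hf'⟩ := hc (q.comap C) (Ideal.comap_isPrime _ _) (lt_of_le_of_ne hle hne)
        exact hf' ((hdecomp q hXq f).1 (hJq (Set.mem_insert_of_mem _ hf)))
      intro f hf
      rw [hdecomp q hXq]
      change eval 0 f ∈ p at hf
      rw [← heq] at hf
      exact hf
  -- Krull's principal ideal theorem: modulo a minimal prime of `J` below `p.map C`, `M` has height
  -- at most one, which leaves no room for `p.map C` to be strictly in between.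
  have hminJ : p.map C ∈ J.minimalPrimes := by
    have := Ideal.mem_minimalPrimes_span_of_mem_minimalPrimes_span_insert hlt X (J : Set R[X]) hmin
      (J : Set R[X]) hJ
      (fun f hf => Ideal.le_radical (Ideal.subset_span (Set.mem_insert_of_mem _ hf)))
    rwa [Ideal.span_eq] at this
  obtain ⟨s, hs⟩ := (IsNoetherian.noetherian p : p.FG)
  have hex : ∀ a : R, a ∈ s → ∃ y : R[X], y ∉ p.map C ∧ ∃ n, C a ^ n * y ∈ J := by
    intro a ha
    have hap : C a ∈ p.map C := Ideal.mem_map_of_mem _ (hs ▸ Ideal.subset_span ha)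
    exact exists_pow_mul_mem_of_mem_minimalPrimes hminJ hap
  choose! y hy n hn using hex
  have hyprod : ∏ a ∈ s, y a ∉ p.map C := by
    rw [hprime.prod_mem_iff]
    push Not
    exact hy
  set Y := ∏ a ∈ s, y a with hY
  set Y' : (R ⧸ p)[X] := Y.map (Ideal.Quotient.mk p) with hY'
  have hY0 : Y' ≠ 0 := by
    intro h0
    apply hyprod
    rw [Ideal.mem_map_C_iff]
    intro i
    rw [← Ideal.Quotient.eq_zero_iff_mem, ← coeff_map, ← hY', h0, coeff_zero]
  -- If `Y(t)` is outside `p`, the factors `y a` can be cancelled in the fibre over `t`, so `q`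
  -- contains every generator of `p`. Hence each `t` in `T` is a root of the nonzero `Y'`.
  have hroot : ∀ t ∈ T, algebraMap k (R ⧸ p) t ∈ Y'.roots.toFinset := by
    intro t ht
    rw [Multiset.mem_toFinset, mem_roots hY0, IsRoot.def, hY',
      show algebraMap k (R ⧸ p) t = Ideal.Quotient.mk p (algebraMap k R t) from rfl,
      eval_map_apply, Ideal.Quotient.eq_zero_iff_mem]
    by_contra hYt
    obtain ⟨q, hq, hqp, hfq⟩ := h t ht
    refine hqp.not_ge ?_
    rw [← hs, Ideal.span_le]
    intro a ha
    have h1 := hfq _ (hn a ha)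
    rw [eval_mul, eval_pow, eval_C] at h1
    rcases hq.mem_or_mem h1 with h2 | h2
    · exact hq.mem_of_pow_mem _ h2
    · exfalso
      apply hYt
      rw [hY, eval_prod]
      exact Ideal.mem_of_dvd _ (Finset.dvd_prod_of_mem _ ha) (hqp.le h2)
  have hinj : Function.Injective (algebraMap k (R ⧸ p)) := (algebraMap k (R ⧸ p)).injective
  exact hT (Set.Finite.of_finite_image
    ((Y'.roots.toFinset.finite_toSet).subset (by rintro _ ⟨t, ht, rfl⟩; exact hroot t ht))
    hinj.injOn)

/-- Over a Jacobson ring a maximal ideal of the polynomial ring contracts to a maximal ideal, and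
the extra variable adds one to the height. -/
theorem height_eq_of_isMaximal_mvPolynomial {k : Type*} [Field k] (n : ℕ)
    (M : Ideal (MvPolynomial (Fin n) k)) [hM : M.IsMaximal] : M.height = n := by
  induction n with
  | zero =>
    have h0 : ringKrullDim (MvPolynomial (Fin 0) k) = 0 := by simp
    have h1 := Ideal.height_le_ringKrullDim_of_ne_top hM.ne_top
    rw [h0] at h1
    have : M.height ≤ 0 := by exact_mod_cast h1
    simpa using this
  | succ n ih =>
    let e := (MvPolynomial.finSuccEquiv k n).toRingEquiv
    have hP : (M.map e).IsMaximal := Ideal.map_isMaximal_of_equiv e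
    have hp : ((M.map e).comap
      (Polynomial.C : MvPolynomial (Fin n) k →+* _)).IsMaximal :=
      Polynomial.isMaximal_comap_C_of_isJacobsonRing _
    have hlies : (M.map e).LiesOver ((M.map e).comap
      (Polynomial.C : MvPolynomial (Fin n) k →+* _)) := ⟨rfl⟩
    rw [← e.height_map M, Polynomial.height_eq_height_add_one
      ((M.map e).comap (Polynomial.C : MvPolynomial (Fin n) k →+* _)) (M.map e), ih]
    rfl

/-- Every maximal ideal of a domain of finite type over a field has full height. -/
theorem ringKrullDim_le_height_of_isMaximal {k A : Type*} [Field k] [CommRing A] [IsDomain A]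
    [Algebra k A] [Algebra.FiniteType k A] (M : Ideal A) [M.IsMaximal] :
    ringKrullDim A ≤ M.height := by
  -- Noether normalization: integrality bounds the dimension of `A` by `s`, and going-down over the
  -- polynomial ring lifts the height `s` of the contraction to `M`.
  obtain ⟨s, g, hinj, hint⟩ := exists_integral_inj_algHom_of_fg k A
  algebraize [g.toRingHom]
  have : FaithfulSMul (MvPolynomial (Fin s) k) A :=
    (faithfulSMul_iff_algebraMap_injective _ _).2 hinj
  have : Algebra.IsIntegral (MvPolynomial (Fin s) k) A := ⟨hint⟩
  have : IsNoetherianRing A := Algebra.FiniteType.isNoetherianRing k A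
  have h1 : ringKrullDim A ≤ s := by
    have : ringKrullDim (MvPolynomial (Fin s) k) = s := by simp
    rw [← this]
    refine Order.krullDim_le_of_strictMono
      (PrimeSpectrum.comap (algebraMap (MvPolynomial (Fin s) k) A)) ?_
    intro I J hIJ
    exact Ideal.IsIntegral.comap_lt_comap hIJ
  have h2 : (M.under (MvPolynomial (Fin s) k)).IsMaximal :=
    Ideal.isMaximal_comap_of_isIntegral_of_isMaximal M
  have h3 := Ideal.height_eq_height_add_of_liesOver_of_hasGoingDown
    (M.under (MvPolynomial (Fin s) k)) M
  rw [height_eq_of_isMaximal_mvPolynomial] at h3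
  refine h1.trans ?_
  rw [h3]
  push_cast
  exact_mod_cast le_self_add

end CommutativeAlgebra

/-! ### Dictionary between closed sets and homogeneous primes of the affine cone. -/

section VanishingIdeal

open MvPolynomial

variable {r : ℕ}

theorem isClosed_iff_mem_algebraicSets {Z : Set (PSpace r)} :
    IsClosed Z ↔ Z ∈ algebraicSets r := by
  rw [← isOpen_compl_iff]
  change Zᶜᶜ ∈ algebraicSets r ↔ _
  rw [compl_compl]

theorem isClosed_zeroSet {S : Set (MvPolynomial (Fin (r + 1)) ℂ)}
    (hS : ∀ f ∈ S, ∃ d : ℕ, f.IsHomogeneous d) : IsClosed (zeroSet S) :=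
  isClosed_iff_mem_algebraicSets.2 ⟨S, hS, rfl⟩

theorem eval_smul_of_isHomogeneous {σ : Type*} {f : MvPolynomial σ ℂ} {d : ℕ}
    (hf : f.IsHomogeneous d) (c : ℂ) (x : σ → ℂ) : eval (c • x) f = c ^ d * eval x f := by
  rw [eval_eq, eval_eq, Finset.mul_sum]
  refine Finset.sum_congr rfl fun u hu => ?_
  have hd : ∑ i ∈ u.support, u i = d := by
    simpa [Finsupp.degree, Finsupp.weight_apply, Finsupp.sum] using hf (mem_support_iff.1 hu)
  simp only [Pi.smul_apply, smul_eq_mul, mul_pow, Finset.prod_mul_distrib, Finset.prod_pow_eq_pow_sum,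
    hd]
  ring

/-- The ideal of the polynomials that vanish on the affine cone over `Y`. -/
def coneIdeal (Y : Set (PSpace r)) : Ideal (MvPolynomial (Fin (r + 1)) ℂ) where
  carrier := {f | ∀ Q ∈ Y, ∀ c : ℂ, eval (c • Q.rep) f = 0}
  add_mem' := by
    intro f g hf hg Q hQ c
    rw [map_add, hf Q hQ c, hg Q hQ c, add_zero]
  zero_mem' := by
    intro Q _ c
    exact map_zero _
  smul_mem' := by
    intro a f hf Q hQ c
    rw [smul_eq_mul, map_mul, hf Q hQ c, mul_zero]

theorem eval_rep_of_mem_coneIdeal {Y : Set (PSpace r)} {f : MvPolynomial (Fin (r + 1)) ℂ}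
    (hf : f ∈ coneIdeal Y) {Q : PSpace r} (hQ : Q ∈ Y) : eval Q.rep f = 0 := by
  simpa using hf Q hQ 1

theorem mem_coneIdeal_of_isHomogeneous {Y : Set (PSpace r)}
    {f : MvPolynomial (Fin (r + 1)) ℂ} {d : ℕ} (hf : f.IsHomogeneous d) :
    f ∈ coneIdeal Y ↔ ∀ Q ∈ Y, eval Q.rep f = 0 := by
  refine ⟨fun h Q hQ => eval_rep_of_mem_coneIdeal h hQ, fun h Q hQ c => ?_⟩
  rw [eval_smul_of_isHomogeneous hf, h Q hQ, mul_zero]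

/-- On the line through `x`, `f` is a polynomial in `c` whose coefficients are the values of its
homogeneous components at `x`. -/
theorem eval_homogeneousComponent_eq_zero {σ : Type*} {f : MvPolynomial σ ℂ} {x : σ → ℂ}
    (h : ∀ c : ℂ, eval (c • x) f = 0) (d : ℕ) : eval x (homogeneousComponent d f) = 0 := by
  by_cases hd : f.totalDegree < d
  · rw [homogeneousComponent_eq_zero _ _ hd, map_zero]
  let p : Polynomial ℂ := ∑ i ∈ Finset.range (f.totalDegree + 1),
    Polynomial.C (eval x (homogeneousComponent i f)) * Polynomial.X ^ i
  have hp : p = 0 := by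
    apply Polynomial.funext
    intro c
    rw [Polynomial.eval_zero, ← h c]
    conv_rhs => rw [← sum_homogeneousComponent f]
    rw [map_sum, Polynomial.eval_finsetSum]
    refine Finset.sum_congr rfl fun i _ => ?_
    rw [eval_smul_of_isHomogeneous (homogeneousComponent_isHomogeneous i f)]
    rw [Polynomial.eval_mul, Polynomial.eval_C, Polynomial.eval_pow, Polynomial.eval_X, mul_comm]
  have := congrArg (fun q => Polynomial.coeff q d) hp
  simp only [p, Polynomial.finsetSum_coeff, Polynomial.coeff_C_mul, Polynomial.coeff_X_pow,
    Polynomial.coeff_zero] at this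
  simpa [Nat.lt_succ_iff, not_lt.1 hd] using this

theorem homogeneousComponent_mem_coneIdeal {Y : Set (PSpace r)}
    {f : MvPolynomial (Fin (r + 1)) ℂ} (hf : f ∈ coneIdeal Y) (d : ℕ) :
    homogeneousComponent d f ∈ coneIdeal Y := by
  rw [mem_coneIdeal_of_isHomogeneous (homogeneousComponent_isHomogeneous d f)]
  exact fun Q hQ => eval_homogeneousComponent_eq_zero (hf Q hQ) d

attribute [local instance] MvPolynomial.gradedAlgebra

theorem isHomogeneous_coneIdeal (Y : Set (PSpace r)) :
    (coneIdeal Y).IsHomogeneous (homogeneousSubmodule (Fin (r + 1)) ℂ) := by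
  intro i f hf
  have := homogeneousComponent_mem_coneIdeal hf i
  rwa [← decomposition.decompose'_apply] at this

theorem one_notMem_coneIdeal {Y : Set (PSpace r)} (hY : Y.Nonempty) :
    (1 : MvPolynomial (Fin (r + 1)) ℂ) ∉ coneIdeal Y := by
  obtain ⟨Q, hQ⟩ := hY
  intro h
  simpa using h Q hQ 1

theorem isPrime_coneIdeal {Y : Set (PSpace r)} (hY : IsIrreducible Y) : (coneIdeal Y).IsPrime := by
  refine (isHomogeneous_coneIdeal Y).isPrime_of_homogeneous_mem_or_mem
    ((Ideal.ne_top_iff_one _).2 (one_notMem_coneIdeal hY.nonempty)) ?_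
  rintro f g ⟨d, hf⟩ ⟨e, hg⟩ hfg
  rw [mem_homogeneousSubmodule] at hf hg
  rw [mem_coneIdeal_of_isHomogeneous hf, mem_coneIdeal_of_isHomogeneous hg]
  have hcl : ∀ {f : MvPolynomial (Fin (r + 1)) ℂ} {d : ℕ}, f.IsHomogeneous d →
      IsClosed (zeroSet {f}) := fun {f d} hf =>
    isClosed_zeroSet (by rintro _ rfl; exact ⟨d, hf⟩)
  have := isPreirreducible_iff_isClosed_union_isClosed.1 hY.isPreirreducible _ _ (hcl hf) (hcl hg)
    (by
      intro Q hQ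
      have h1 := eval_rep_of_mem_coneIdeal hfg hQ
      rw [map_mul, mul_eq_zero] at h1
      exact h1.imp (by rintro h _ rfl; exact h) (by rintro h _ rfl; exact h))
  exact this.imp (fun h Q hQ => h hQ f rfl) (fun h Q hQ => h hQ g rfl)

theorem mem_iff_of_isClosed {Y : Set (PSpace r)} (hY : IsClosed Y) {Q : PSpace r} :
    Q ∈ Y ↔ ∀ f ∈ coneIdeal Y, (∃ d : ℕ, f.IsHomogeneous d) → eval Q.rep f = 0 := by
  refine ⟨fun hQ f hf _ => eval_rep_of_mem_coneIdeal hf hQ, fun h => ?_⟩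
  obtain ⟨S, hS, rfl⟩ := isClosed_iff_mem_algebraicSets.1 hY
  intro f hf
  obtain ⟨d, hd⟩ := hS f hf
  exact h f ((mem_coneIdeal_of_isHomogeneous hd).2 fun Q hQ => hQ f hf) ⟨d, hd⟩

theorem coneIdeal_anti {Y Z : Set (PSpace r)} (h : Y ⊆ Z) : coneIdeal Z ≤ coneIdeal Y :=
  fun _ hf Q hQ => hf Q (h hQ)

theorem subset_of_coneIdeal_le {Y Z : Set (PSpace r)} (hZ : IsClosed Z)
    (h : coneIdeal Z ≤ coneIdeal Y) : Y ⊆ Z := by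
  intro Q hQ
  rw [mem_iff_of_isClosed hZ]
  exact fun f hf _ => eval_rep_of_mem_coneIdeal (h hf) hQ

theorem coneIdeal_lt {Y Z : Set (PSpace r)} (hY : IsClosed Y) (h : Y ⊂ Z) :
    coneIdeal Z < coneIdeal Y :=
  lt_of_le_not_ge (coneIdeal_anti h.subset) fun h' => h.not_subset (subset_of_coneIdeal_le hY h')

/-- Two proportional points of the affine cone define the same point. -/
theorem eq_of_rep_eq_smul {P Q : PSpace r} {c : ℂ} (h : Q.rep = c • P.rep) : Q = P := by
  rw [← Q.mk_rep, ← P.mk_rep, Projectivization.mk_eq_mk_iff']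
  exact ⟨c, h.symm⟩

theorem exists_rep_ne_zero (P : PSpace r) : ∃ j, P.rep j ≠ 0 := by
  by_contra! h
  exact P.rep_nonzero (funext h)

theorem isClosed_singleton_point (P : PSpace r) : IsClosed ({P} : Set (PSpace r)) := by
  obtain ⟨j, hj⟩ := exists_rep_ne_zero P
  let S : Set (MvPolynomial (Fin (r + 1)) ℂ) :=
    Set.range fun i : Fin (r + 1) => C (P.rep j) * X i - C (P.rep i) * X j
  have : ({P} : Set (PSpace r)) = zeroSet S := by
    ext Q
    simp only [Set.mem_singleton_iff]
    constructor
    · rintro rfl _ ⟨i, rfl⟩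
      simp [mul_comm]
    · intro h
      apply eq_of_rep_eq_smul (c := Q.rep j / P.rep j)
      funext i
      have := h _ ⟨i, rfl⟩
      simp only [map_sub, map_mul, eval_C, eval_X, sub_eq_zero] at this
      rw [Pi.smul_apply, smul_eq_mul, div_mul_eq_mul_div, eq_div_iff hj]
      linear_combination this
  rw [this]
  refine isClosed_zeroSet ?_
  rintro _ ⟨i, rfl⟩
  exact ⟨1, ((isHomogeneous_C_mul_X _ _).sub (isHomogeneous_C_mul_X _ _))⟩

/-- The ideal of the vertex of the cone. -/
noncomputable def vertexIdeal (r : ℕ) : Ideal (MvPolynomial (Fin (r + 1)) ℂ) :=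
  RingHom.ker (eval (0 : Fin (r + 1) → ℂ))

theorem coneIdeal_lt_vertexIdeal {Y : Set (PSpace r)} (hY : Y.Nonempty) :
    coneIdeal Y < vertexIdeal r := by
  obtain ⟨Q, hQ⟩ := hY
  refine lt_of_le_not_ge (fun f hf => ?_) fun h => ?_
  · simpa [vertexIdeal, RingHom.mem_ker] using hf Q hQ 0
  · obtain ⟨j, hj⟩ := exists_rep_ne_zero Q
    have : (X j : MvPolynomial (Fin (r + 1)) ℂ) ∈ vertexIdeal r := by
      simp [vertexIdeal, RingHom.mem_ker]
    exact hj (by simpa using eval_rep_of_mem_coneIdeal (h this) hQ)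

/-- Chains of irreducible closed sets give chains of cone ideals, and the vertex, attached as `⊥`,
adds one step. -/
theorem topologicalKrullDim_add_one_le {X : Set (PSpace r)} (hX : IsClosed X)
    (hirr : IsIrreducible X) :
    topologicalKrullDim X + 1 ≤
      ringKrullDim (MvPolynomial (Fin (r + 1)) ℂ ⧸ coneIdeal X) := by
  have hne : Nonempty (TopologicalSpace.IrreducibleCloseds X) := by
    have := Subtype.irreducibleSpace hirr
    exact ⟨⟨Set.univ, IrreducibleSpace.isIrreducible_univ _, isClosed_univ⟩⟩
  rw [ringKrullDim_quotient, topologicalKrullDim, ← Order.krullDim_withBot,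
    ← Order.krullDim_orderDual (α := PrimeSpectrum.zeroLocus _)]
  have hirr' : ∀ Z : TopologicalSpace.IrreducibleCloseds X,
      IsIrreducible (Subtype.val '' (Z : Set X)) := fun Z =>
    Z.isIrreducible.image _ continuous_subtype_val.continuousOn
  have hcl' : ∀ Z : TopologicalSpace.IrreducibleCloseds X,
      IsClosed (Subtype.val '' (Z : Set X)) := fun Z =>
    hX.isClosedEmbedding_subtypeVal.isClosedMap _ Z.isClosed
  have hle : ∀ Z : TopologicalSpace.IrreducibleCloseds X,
      coneIdeal X ≤ coneIdeal (Subtype.val '' (Z : Set X)) := fun Z =>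
    coneIdeal_anti (by rintro _ ⟨x, _, rfl⟩; exact x.2)
  let φ : WithBot (TopologicalSpace.IrreducibleCloseds X) →
      (PrimeSpectrum.zeroLocus (coneIdeal X : Set (MvPolynomial (Fin (r + 1)) ℂ)))ᵒᵈ :=
    fun Z => OrderDual.toDual <| WithBot.recBotCoe
      ⟨⟨vertexIdeal r, RingHom.ker_isPrime _⟩, (coneIdeal_lt_vertexIdeal hirr.nonempty).le⟩
      (fun Z => ⟨⟨coneIdeal (Subtype.val '' (Z : Set X)), isPrime_coneIdeal (hirr' Z)⟩, hle Z⟩) Z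
  refine Order.krullDim_le_of_strictMono φ ?_
  intro Z W hZW
  induction W using WithBot.recBotCoe with
  | bot => exact absurd hZW not_lt_bot
  | coe W =>
    induction Z using WithBot.recBotCoe with
    | bot => exact coneIdeal_lt_vertexIdeal (hirr' W).nonempty
    | coe Z =>
      have h1 : (Z : Set X) ⊂ W := SetLike.coe_ssubset_coe.2 (WithBot.coe_lt_coe.1 hZW)
      exact coneIdeal_lt (hcl' Z) (Subtype.val_injective.image_strictMono h1)

theorem exists_eval_ne_zero {q : Ideal (MvPolynomial (Fin (r + 1)) ℂ)} [q.IsPrime]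
    {P : PSpace r} (hq : q ≤ coneIdeal {P})
    (hhom : q.IsHomogeneous (homogeneousSubmodule (Fin (r + 1)) ℂ))
    {f : MvPolynomial (Fin (r + 1)) ℂ} (hf : f ∉ q) :
    ∃ (Q : PSpace r) (c : ℂ), (∀ g ∈ q, eval Q.rep g = 0) ∧ eval (c • Q.rep) f ≠ 0 := by
  obtain ⟨j, hj⟩ := exists_rep_ne_zero P
  have hXj : (X j : MvPolynomial (Fin (r + 1)) ℂ) ∉ q := by
    intro h
    exact hj (by simpa using eval_rep_of_mem_coneIdeal (hq h) rfl)
  -- The factor `X j` keeps the point given by the Nullstellensatz away from the vertex, so that it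
  -- defines a projective point.
  have hmul : f * X j ∉ q := fun h => ((Ideal.IsPrime.mem_or_mem ‹_› h).elim hf hXj)
  rw [← IsPrime.vanishingIdeal_zeroLocus (K := ℂ) q, mem_vanishingIdeal_iff] at hmul
  push Not at hmul
  obtain ⟨x, hx, hfx⟩ := hmul
  rw [map_mul, aeval_X, mul_ne_zero_iff] at hfx
  have hx0 : x ≠ 0 := by
    rintro rfl
    exact hfx.2 rfl
  obtain ⟨a, ha⟩ := Projectivization.exists_smul_eq_mk_rep ℂ x hx0
  have hax : x = (a : ℂ)⁻¹ • (Projectivization.mk ℂ x hx0).rep := by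
    rw [← ha, Units.smul_def, smul_smul, inv_mul_cancel₀ a.ne_zero, one_smul]
  refine ⟨Projectivization.mk ℂ x hx0, (a : ℂ)⁻¹, fun g hg => ?_, ?_⟩
  · rw [← ha, Units.smul_def, ← sum_homogeneousComponent g, map_sum]
    refine Finset.sum_eq_zero fun i _ => ?_
    rw [eval_smul_of_isHomogeneous (homogeneousComponent_isHomogeneous i g)]
    have : aeval x (homogeneousComponent i g) = 0 :=
      hx _ (homogeneousComponent_mem_of_mem hhom hg i)
    rw [show eval x (homogeneousComponent i g) = 0 from this, mul_zero]
  · rw [← hax]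
    simpa [coe_aeval_eq_eval] using hfx.1

theorem exists_irreducible_of_prime_lt {q : Ideal (MvPolynomial (Fin (r + 1)) ℂ)} [hqp : q.IsPrime]
    {P : PSpace r} (hq : q < coneIdeal {P})
    (hhom : q.IsHomogeneous (homogeneousSubmodule (Fin (r + 1)) ℂ)) :
    ∃ Z : Set (PSpace r), IsClosed Z ∧ IsIrreducible Z ∧ P ∈ Z ∧ 0 < topologicalKrullDim Z ∧
      ∀ Q ∈ Z, ∀ f ∈ q, (∃ d : ℕ, f.IsHomogeneous d) → eval Q.rep f = 0 := by
  let Z : Set (PSpace r) := zeroSet {f | f ∈ q ∧ ∃ d : ℕ, f.IsHomogeneous d}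
  have hmem : ∀ Q : PSpace r, (∀ g ∈ q, eval Q.rep g = 0) → Q ∈ Z := fun Q h f hf => h f hf.1
  have hPZ : P ∈ Z := hmem P fun g hg => eval_rep_of_mem_coneIdeal (hq.le hg) rfl
  have hirr : IsIrreducible Z := by
    refine ⟨⟨P, hPZ⟩, ?_⟩
    rw [isPreirreducible_iff_isClosed_union_isClosed]
    intro A B hA hB hAB
    by_contra! hc
    obtain ⟨hcA, hcB⟩ := hc
    have key : ∀ A : Set (PSpace r), IsClosed A → ¬ Z ⊆ A → ∃ f ∈ coneIdeal A, f ∉ q := by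
      intro A hA hZA
      obtain ⟨Q, hQ, hQA⟩ := Set.not_subset.1 hZA
      rw [mem_iff_of_isClosed hA] at hQA
      push Not at hQA
      obtain ⟨f, hf, hd, hfQ⟩ := hQA
      exact ⟨f, hf, fun hfq => hfQ (hQ f ⟨hfq, hd⟩)⟩
    obtain ⟨f, hf, hfq⟩ := key A hA hcA
    obtain ⟨g, hg, hgq⟩ := key B hB hcB
    obtain ⟨Q, c, hQ, hfg⟩ := exists_eval_ne_zero hq.le hhom
      (fun h => (hqp.mem_or_mem h).elim hfq hgq : f * g ∉ q)
    rw [map_mul, mul_ne_zero_iff] at hfg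
    rcases hAB (hmem Q hQ) with h | h
    · exact hfg.1 (hf Q h c)
    · exact hfg.2 (hg Q h c)
  refine ⟨Z, isClosed_zeroSet fun f hf => hf.2, hirr, hPZ, ?_, fun Q hQ f hf hd => hQ f ⟨hf, hd⟩⟩
  -- Strictness of `hq` yields a point of `Z` other than `P`, hence the chain `{P} ⊂ Z`.
  obtain ⟨f, hfP, hfq⟩ := SetLike.exists_of_lt hq
  obtain ⟨Q, c, hQ, hfQ⟩ := exists_eval_ne_zero hq.le hhom hfq
  have hQP : Q ≠ P := by
    rintro rfl
    exact hfQ (hfP Q rfl c)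
  have := Subtype.irreducibleSpace hirr
  let A : TopologicalSpace.IrreducibleCloseds Z := ⟨{⟨P, hPZ⟩}, isIrreducible_singleton, by
    convert (isClosed_singleton_point P).preimage (continuous_subtype_val (p := (· ∈ Z)))
    ext x
    simp [Subtype.ext_iff]⟩
  let B : TopologicalSpace.IrreducibleCloseds Z :=
    ⟨Set.univ, IrreducibleSpace.isIrreducible_univ _, isClosed_univ⟩
  have hAB : A < B := by
    refine SetLike.coe_ssubset_coe.1 ⟨Set.subset_univ _, fun h => hQP ?_⟩
    have : (⟨Q, hmem Q hQ⟩ : Z) ∈ ({⟨P, hPZ⟩} : Set Z) := h (Set.mem_univ _)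
    exact congrArg Subtype.val this
  exact Order.krullDim_pos_iff.2 ⟨A, B, hAB⟩

theorem coneIdeal_lt_of_topologicalKrullDim_pos {Z : Set (PSpace r)} {P : PSpace r}
    (hP : P ∈ Z) (hdim : 0 < topologicalKrullDim Z) : coneIdeal Z < coneIdeal {P} := by
  refine coneIdeal_lt (isClosed_singleton_point P) ⟨by simpa using hP, fun h => ?_⟩
  have hsub : Subsingleton Z := ⟨fun a b => Subtype.ext ((h a.2).trans (h b.2).symm)⟩
  have : Subsingleton (TopologicalSpace.IrreducibleCloseds Z) := by
    refine ⟨fun A B => TopologicalSpace.IrreducibleCloseds.ext ?_⟩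
    rw [A.isIrreducible.nonempty.eq_univ, B.isIrreducible.nonempty.eq_univ]
  have := Order.krullDim_nonpos_of_subsingleton (α := TopologicalSpace.IrreducibleCloseds Z)
  exact absurd hdim (not_lt.2 this)

end VanishingIdeal

/-! ### Tangent and conormal spaces; the lower bound for the tangent dimension. -/

section TangentSpace

open MvPolynomial

variable {r : ℕ}

/-- The gradient of a polynomial at a point. -/
noncomputable def gradient (p : Fin (r + 1) → ℂ) :
    MvPolynomial (Fin (r + 1)) ℂ →ₗ[ℂ] (Fin (r + 1) → ℂ) :=
  LinearMap.pi fun j => (aeval p).toLinearMap ∘ₗ (pderiv j).toLinearMap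

@[simp]
theorem gradient_apply (p : Fin (r + 1) → ℂ) (f : MvPolynomial (Fin (r + 1)) ℂ)
    (j : Fin (r + 1)) : gradient p f j = eval p (pderiv j f) := rfl

/-- The space of the gradients at `P` of the equations of `X`. -/
noncomputable def conormalSpace (X : Set (PSpace r)) (P : PSpace r) :
    Submodule ℂ (Fin (r + 1) → ℂ) :=
  Submodule.span ℂ {w | ∃ f ∈ coneIdeal X, (∃ d : ℕ, f.IsHomogeneous d) ∧ gradient P.rep f = w}

theorem gradient_mem_conormalSpace {X : Set (PSpace r)} {f : MvPolynomial (Fin (r + 1)) ℂ}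
    (hf : f ∈ coneIdeal X) (P : PSpace r) : gradient P.rep f ∈ conormalSpace X P := by
  rw [← sum_homogeneousComponent f, map_sum]
  exact Submodule.sum_mem _ fun d _ => Submodule.subset_span
    ⟨_, homogeneousComponent_mem_coneIdeal hf d, ⟨d, homogeneousComponent_isHomogeneous d f⟩, rfl⟩

theorem exists_gradient_eq {X : Set (PSpace r)} {P : PSpace r} {w : Fin (r + 1) → ℂ}
    (hw : w ∈ conormalSpace X P) : ∃ f ∈ coneIdeal X, gradient P.rep f = w := by
  have : conormalSpace X P ≤
      ((coneIdeal X).restrictScalars ℂ).map (gradient P.rep) := by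
    rw [conormalSpace, Submodule.span_le]
    rintro _ ⟨f, hf, _, rfl⟩
    exact ⟨f, hf, rfl⟩
  exact this hw

theorem tangentSpace_eq_dualCoannihilator (X : Set (PSpace r)) (P : PSpace r) :
    tangentSpace X P =
      ((conormalSpace X P).map (dotProductEquiv ℂ (Fin (r + 1))).toLinearMap).dualCoannihilator := by
  ext v
  rw [Submodule.mem_dualCoannihilator]
  constructor
  · rintro hv _ ⟨w, hw, rfl⟩
    refine Submodule.span_induction (p := fun w _ => dotProductEquiv ℂ (Fin (r + 1)) w v = 0)
      ?_ ?_ ?_ ?_ hw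
    · rintro _ ⟨f, hf, hd, rfl⟩
      exact hv f hd fun Q hQ => eval_rep_of_mem_coneIdeal hf hQ
    · simp
    · intro a b _ _ ha hb
      rw [map_add, LinearMap.add_apply, ha, hb, add_zero]
    · intro c a _ ha
      rw [map_smul, LinearMap.smul_apply, ha, smul_zero]
  · intro h f ⟨d, hd⟩ hf
    exact h _ ⟨_, gradient_mem_conormalSpace ((mem_coneIdeal_of_isHomogeneous hd).2 hf) P, rfl⟩

theorem finrank_conormalSpace_add_finrank_tangentSpace (X : Set (PSpace r)) (P : PSpace r) :
    Module.finrank ℂ (conormalSpace X P) + Module.finrank ℂ (tangentSpace X P) = r + 1 := by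
  have := Subspace.finrank_add_finrank_dualCoannihilator_eq
    ((conormalSpace X P).map (dotProductEquiv ℂ (Fin (r + 1))).toLinearMap)
  rw [← tangentSpace_eq_dualCoannihilator, LinearEquiv.finrank_map_eq] at this
  simpa using this

theorem mem_conormalSpace_iff {X : Set (PSpace r)} {P : PSpace r} {h : Fin (r + 1) → ℂ} :
    h ∈ conormalSpace X P ↔ ∀ v ∈ tangentSpace X P, h ⬝ᵥ v = 0 := by
  have key := Subspace.dualCoannihilator_dualAnnihilator_eq
    (W := (conormalSpace X P).map (dotProductEquiv ℂ (Fin (r + 1))).toLinearMap)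
  rw [← tangentSpace_eq_dualCoannihilator] at key
  have h1 : h ∈ conormalSpace X P ↔ dotProductEquiv ℂ (Fin (r + 1)) h ∈
      (conormalSpace X P).map (dotProductEquiv ℂ (Fin (r + 1))).toLinearMap := by
    constructor
    · exact fun hh => ⟨h, hh, rfl⟩
    · rintro ⟨w, hw, hwh⟩
      rwa [← (dotProductEquiv ℂ (Fin (r + 1))).injective hwh]
  rw [h1, ← key, Submodule.mem_dualAnnihilator]
  rfl

theorem sub_linear_mem_sq (p : Fin (r + 1) → ℂ) (f : MvPolynomial (Fin (r + 1)) ℂ) :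
    f - C (eval p f) - ∑ j, C (eval p (pderiv j f)) * (X j - C (p j)) ∈
      (RingHom.ker (eval p)) ^ 2 := by
  have hX : ∀ j, (X j - C (p j) : MvPolynomial (Fin (r + 1)) ℂ) ∈ RingHom.ker (eval p) := by
    intro j
    simp [RingHom.mem_ker]
  induction f using MvPolynomial.induction_on with
  | C a => simp
  | add f g hf hg =>
    convert Ideal.add_mem _ hf hg using 1
    simp only [map_add, add_mul, Finset.sum_add_distrib]
    ring
  | mul_X f i hf =>
    have h1 : (f - C (eval p f)) * (X i - C (p i)) ∈ (RingHom.ker (eval p)) ^ 2 := by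
      rw [pow_two]
      exact Ideal.mul_mem_mul (by simp [RingHom.mem_ker]) (hX i)
    have h2 := Ideal.mul_mem_left _ (C (p i)) hf
    convert Ideal.add_mem _ h1 h2 using 1
    have : ∀ j, (C (eval p (pderiv j (f * X i))) * (X j - C (p j)) :
        MvPolynomial (Fin (r + 1)) ℂ) = C (p i) * (C (eval p (pderiv j f)) * (X j - C (p j))) +
          if j = i then C (eval p f) * (X i - C (p i)) else 0 := by
      intro j
      rw [pderiv_mul, map_add, map_mul, map_mul, pderiv_X]
      split_ifs with h
      · subst h
        simp
        ring
      · simp [Ne.symm h]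
        ring
    simp only [this, Finset.sum_add_distrib, Finset.sum_ite_eq', Finset.mem_univ, if_true,
      ← Finset.mul_sum, map_mul, eval_X]
    ring

theorem mem_sq_of_gradient_eq_zero {p : Fin (r + 1) → ℂ} {f : MvPolynomial (Fin (r + 1)) ℂ}
    (h0 : eval p f = 0) (h1 : gradient p f = 0) : f ∈ (RingHom.ker (eval p)) ^ 2 := by
  have := sub_linear_mem_sq p f
  have h2 : ∀ j, eval p (pderiv j f) = 0 := fun j => congrFun h1 j
  simpa [h0, h2] using this

/-- The maximal ideal of a point of the cone is minimal over the sum of the ideal of `X` and as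
many linear polynomials as the dimension of the tangent space. -/
theorem exists_finset_ker_eval_mem_minimalPrimes {X : Set (PSpace r)} {P : PSpace r} (hP : P ∈ X) :
    ∃ s : Finset (MvPolynomial (Fin (r + 1)) ℂ),
      s.card ≤ Module.finrank ℂ (tangentSpace X P) ∧
      RingHom.ker (eval P.rep) ∈ (coneIdeal X ⊔ Ideal.span (s : Set _)).minimalPrimes := by
  classical
  obtain ⟨W, hW⟩ := Submodule.exists_isCompl (conormalSpace X P)
  have hWdim : Module.finrank ℂ W = Module.finrank ℂ (tangentSpace X P) := by
    have h1 := Submodule.finrank_add_eq_of_isCompl hW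
    have h2 := finrank_conormalSpace_add_finrank_tangentSpace X P
    simp only [Module.finrank_fin_fun] at h1
    omega
  let b := Module.finBasis ℂ W
  let lin : (Fin (r + 1) → ℂ) → MvPolynomial (Fin (r + 1)) ℂ :=
    fun w => ∑ j, C (w j) * (MvPolynomial.X j - C (P.rep j))
  have hlin0 : ∀ w, eval P.rep (lin w) = 0 := by
    intro w
    simp [lin]
  have hlin1 : ∀ w, gradient P.rep (lin w) = w := by
    intro w
    funext i
    simp [lin, pderiv_X, Pi.single_apply]
  let s : Finset (MvPolynomial (Fin (r + 1)) ℂ) := Finset.univ.image fun i => lin (b i)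
  have hIle : coneIdeal X ≤ RingHom.ker (eval P.rep) := fun f hf =>
    eval_rep_of_mem_coneIdeal hf hP
  -- Modulo the square of the maximal ideal only the gradient matters: its conormal part comes from
  -- an equation of `X`, its part in `W` from the linear forms in `s`.
  have hmax : RingHom.ker (eval P.rep) ≤
      (coneIdeal X ⊔ Ideal.span (s : Set _)) ⊔ (RingHom.ker (eval P.rep)) ^ 2 := by
    intro g hg
    obtain ⟨w, hw, u, hu, hwu⟩ := Submodule.mem_sup.1
      ((hW.sup_eq_top ▸ Submodule.mem_top : gradient P.rep g ∈ conormalSpace X P ⊔ W))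
    obtain ⟨f, hf, hfw⟩ := exists_gradient_eq hw
    have hspan : ∃ l ∈ Ideal.span (s : Set (MvPolynomial (Fin (r + 1)) ℂ)),
        eval P.rep l = 0 ∧ gradient P.rep l = u := by
      refine ⟨∑ i, C (b.repr ⟨u, hu⟩ i) * lin (b i), ?_, ?_, ?_⟩
      · exact Ideal.sum_mem _ fun i _ => Ideal.mul_mem_left _ _
          (Ideal.subset_span (by simp [s]))
      · simp [hlin0]
      · simp only [← smul_eq_C_mul, map_sum, map_smul, hlin1]
        have := congrArg W.subtype (b.sum_repr ⟨u, hu⟩)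
        simpa only [map_sum, map_smul, Submodule.subtype_apply] using this
    obtain ⟨l, hl, hl0, hlu⟩ := hspan
    have hrest : g - f - l ∈ (RingHom.ker (eval P.rep)) ^ 2 := by
      apply mem_sq_of_gradient_eq_zero
      · rw [map_sub, map_sub, hl0, show eval P.rep f = 0 from hIle hf,
          show eval P.rep g = 0 from hg]
        simp
      · rw [map_sub, map_sub, hfw, hlu, ← hwu]
        abel
    have : g = (f + l) + (g - f - l) := by ring
    rw [this]
    exact Ideal.add_mem _ (Ideal.mem_sup_left (Ideal.add_mem _ (Ideal.mem_sup_left hf)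
      (Ideal.mem_sup_right hl))) (Ideal.mem_sup_right hrest)
  refine ⟨s, ?_, ⟨RingHom.ker_isPrime _, sup_le hIle ?_⟩, ?_⟩
  · refine Finset.card_image_le.trans ?_
    simp [hWdim]
  · rw [Ideal.span_le]
    intro g hg
    obtain ⟨i, _, rfl⟩ := Finset.mem_image.1 (Finset.mem_coe.1 hg)
    exact hlin0 _
  · rintro q ⟨hq, hIq⟩ hqm
    -- Nakayama: some `a` congruent to `1` modulo the maximal ideal multiplies that ideal into `q`.
    obtain ⟨a, ha, hale⟩ := Submodule.exists_sub_one_mem_and_smul_le_of_fg_of_le_sup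
      (I := RingHom.ker (eval P.rep)) (N := q) (N' := RingHom.ker (eval P.rep))
      (P := RingHom.ker (eval P.rep)) (IsNoetherian.noetherian _) le_rfl (by
        rw [smul_eq_mul, ← pow_two]
        exact hmax.trans (sup_le_sup_right hIq _))
    have haq : a ∉ q := by
      intro h
      have h1 := hqm h
      rw [RingHom.mem_ker] at h1 ha
      rw [map_sub, h1, map_one] at ha
      norm_num at ha
    intro f hf
    exact (hq.mem_or_mem (hale (Submodule.smul_mem_pointwise_smul f a _ hf))).resolve_left haq

/-- Krull's height theorem in the coordinate ring of the cone: the maximal ideal of the point has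
full height, yet is minimal over at most `finrank` of the tangent space many elements. -/
theorem finrank_tangentSpace_ge {X : Set (PSpace r)} (hX : IsClosed X) (hirr : IsIrreducible X)
    {P : PSpace r} (hP : P ∈ X) :
    topologicalKrullDim X + 1 ≤ (Module.finrank ℂ (tangentSpace X P) : WithBot ℕ∞) := by
  classical
  have hprime := isPrime_coneIdeal hirr
  refine (topologicalKrullDim_add_one_le hX hirr).trans ?_
  have hM : (RingHom.ker (eval P.rep)).IsMaximal :=
    RingHom.ker_isMaximal_of_surjective _ fun c => ⟨C c, by simp⟩
  have hle : coneIdeal X ≤ RingHom.ker (eval P.rep) := fun f hf =>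
    eval_rep_of_mem_coneIdeal hf hP
  have hsurj := Ideal.Quotient.mk_surjective (I := coneIdeal X)
  have hM' : ((RingHom.ker (eval P.rep)).map (Ideal.Quotient.mk (coneIdeal X))).IsMaximal :=
    Ideal.IsMaximal.map_of_surjective_of_ker_le hsurj (by simpa using hle)
  refine (ringKrullDim_le_height_of_isMaximal (k := ℂ)
    ((RingHom.ker (eval P.rep)).map (Ideal.Quotient.mk (coneIdeal X)))).trans ?_
  obtain ⟨s, hs, hmin⟩ := exists_finset_ker_eval_mem_minimalPrimes hP
  have hmin' : (RingHom.ker (eval P.rep)).map (Ideal.Quotient.mk (coneIdeal X)) ∈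
      (Ideal.span ((s.image (Ideal.Quotient.mk (coneIdeal X)) : Finset _) :
        Set (MvPolynomial (Fin (r + 1)) ℂ ⧸ coneIdeal X))).minimalPrimes := by
    refine ⟨⟨hM'.isPrime, ?_⟩, ?_⟩
    · rw [Finset.coe_image, ← Ideal.map_span]
      exact Ideal.map_mono (le_sup_right.trans hmin.le)
    · rintro q ⟨hq, hsq⟩ hqm
      rw [Ideal.map_le_iff_le_comap]
      refine hmin.2 ⟨Ideal.comap_isPrime _ _, sup_le ?_ ?_⟩ ?_
      · intro f hf
        rw [Ideal.mem_comap, Ideal.Quotient.eq_zero_iff_mem.2 hf]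
        exact q.zero_mem
      · rw [Finset.coe_image, ← Ideal.map_span, Ideal.map_le_iff_le_comap] at hsq
        exact hsq
      · refine (Ideal.comap_mono hqm).trans ?_
        rw [Ideal.comap_map_of_surjective' _ hsurj, Ideal.mk_ker, sup_eq_left.2 hle]
  have h1 := Ideal.height_le_card_of_mem_minimalPrimes_span_finset hmin'
  have h2 : ((s.image (Ideal.Quotient.mk (coneIdeal X))).card : ℕ∞) ≤
      (Module.finrank ℂ (tangentSpace X P) : ℕ∞) := by
    exact_mod_cast Finset.card_image_le.trans hs
  exact_mod_cast h1.trans h2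

end TangentSpace

/-! ### Determinantal equations of tangency and semicontinuity of contact in a pencil. -/

section Contact

open MvPolynomial

variable {r : ℕ}

theorem exists_det_mul_ne_zero {K ι κ : Type*} [Field K] [Fintype ι] [DecidableEq ι] [Fintype κ]
    {A : ι → κ → K} (hA : LinearIndependent K A) :
    ∃ B : Matrix κ ι K, (Matrix.of A * B).det ≠ 0 := by
  have hrank : (Matrix.of A).rank = Fintype.card ι := LinearIndependent.rank_matrix hA
  have hsurj : Function.Surjective (Matrix.of A).mulVec := by
    have : LinearMap.range (Matrix.of A).mulVecLin = ⊤ := by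
      apply Submodule.eq_top_of_finrank_eq
      rw [Module.finrank_fintype_fun_eq_card]
      exact hrank
    exact LinearMap.range_eq_top.1 this
  obtain ⟨B, hB⟩ := Matrix.mulVec_surjective_iff_exists_right_inverse.1 hsurj
  exact ⟨B, by rw [hB, Matrix.det_one]; exact one_ne_zero⟩

theorem linearIndependent_of_det_mul_ne_zero {K ι κ : Type*} [Field K] [Fintype ι] [DecidableEq ι]
    [Fintype κ] {A : ι → κ → K} {B : Matrix κ ι K} (h : (Matrix.of A * B).det ≠ 0) :
    LinearIndependent K A := by
  have h1 := Matrix.linearIndependent_rows_of_det_ne_zero h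
  replace h1 := Matrix.vecMul_injective_iff.2 h1
  have h2 : Function.Injective (Matrix.of A).vecMul := by
    intro x y hxy
    apply h1
    have hxy' : Matrix.vecMul x (Matrix.of A) = Matrix.vecMul y (Matrix.of A) := hxy
    change Matrix.vecMul x (Matrix.of A * B) = Matrix.vecMul y (Matrix.of A * B)
    rw [← Matrix.vecMul_vecMul, ← Matrix.vecMul_vecMul, hxy']
  exact Matrix.vecMul_injective_iff.1 h2

/-- A linear combination of the maximal minors of a matrix of polynomials, given as the
determinant of its product with a constant matrix. -/
noncomputable def minor {σ ι κ : Type*} [Fintype ι] [DecidableEq ι] [Fintype κ]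
    (G : ι → κ → MvPolynomial σ ℂ) (B : Matrix κ ι ℂ) : MvPolynomial σ ℂ :=
  (Matrix.of fun i j => ∑ l, G i l * C (B l j)).det

theorem eval_minor {σ ι κ : Type*} [Fintype ι] [DecidableEq ι] [Fintype κ]
    (G : ι → κ → MvPolynomial σ ℂ) (B : Matrix κ ι ℂ) (p : σ → ℂ) :
    eval p (minor G B) = (Matrix.of (fun i j => eval p (G i j)) * B).det := by
  rw [minor, RingHom.map_det]
  congr 1
  ext i j
  simp [Matrix.mul_apply]

theorem isHomogeneous_minor {σ ι κ : Type*} [Fintype ι] [DecidableEq ι] [Fintype κ]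
    {G : ι → κ → MvPolynomial σ ℂ} (B : Matrix κ ι ℂ) {d : ι → ℕ}
    (hG : ∀ i j, (G i j).IsHomogeneous (d i)) : (minor G B).IsHomogeneous (∑ i, d i) := by
  rw [minor, Matrix.det_apply']
  refine IsHomogeneous.sum _ _ _ fun τ _ => ?_
  have h1 : (∏ i, ∑ l, G (τ i) l * C (B l i)).IsHomogeneous (∑ i, d (τ i)) := by
    refine IsHomogeneous.prod _ _ _ fun i _ => ?_
    refine IsHomogeneous.sum _ _ _ fun j _ => ?_
    simpa using (hG (τ i) j).mul (isHomogeneous_C σ (B j i))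
  rw [Equiv.sum_comp τ d] at h1
  have h2 := h1.C_mul (((Equiv.Perm.sign τ : ℤˣ) : ℤ) : ℂ)
  simpa using h2

/-- The rows of the Jacobian matrix of `F`, preceded by the coordinates of the hyperplane `h`. -/
noncomputable def contactRows {c : ℕ} (h : Fin (r + 1) → ℂ)
    (F : Fin c → MvPolynomial (Fin (r + 1)) ℂ) :
    Fin (c + 1) → Fin (r + 1) → MvPolynomial (Fin (r + 1)) ℂ :=
  Fin.cons (fun j => C (h j)) fun i j => pderiv j (F i)

/-- Only row `0` involves the hyperplane, and the determinant is linear in that row. -/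
theorem minor_contactRows_add_smul {c : ℕ} (h h' : Fin (r + 1) → ℂ) (t : ℂ)
    (F : Fin c → MvPolynomial (Fin (r + 1)) ℂ) (B : Matrix (Fin (r + 1)) (Fin (c + 1)) ℂ) :
    minor (contactRows (h + t • h') F) B =
      minor (contactRows h F) B + C t * minor (contactRows h' F) B := by
  let M : (Fin (r + 1) → ℂ) → Matrix (Fin (c + 1)) (Fin (c + 1)) (MvPolynomial (Fin (r + 1)) ℂ) :=
    fun h => Matrix.of fun i j => ∑ l, contactRows h F i l * C (B l j)
  have h1 : ∀ u, M u = (M h).updateRow 0 (M u 0) := by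
    intro u
    refine Matrix.ext fun i j => ?_
    refine Fin.cases ?_ (fun i => ?_) i
    · rw [Matrix.updateRow_self]
    · rw [Matrix.updateRow_ne (Fin.succ_ne_zero i)]
      simp [M, contactRows]
  have h2 : M (h + t • h') 0 = M h 0 + (C t : MvPolynomial (Fin (r + 1)) ℂ) • M h' 0 := by
    funext j
    simp only [M, contactRows, Matrix.of_apply, Fin.cons_zero, Pi.add_apply,
      Pi.smul_apply, smul_eq_mul, map_add, map_mul, add_mul, Finset.sum_add_distrib,
      Finset.mul_sum, mul_assoc]
  change (M (h + t • h')).det = (M h).det + C t * (M h').det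
  rw [h1 (h + t • h'), h2, Matrix.det_updateRow_add, Matrix.det_updateRow_smul,
    Matrix.updateRow_eq_self, ← h1 h']

theorem eval_contactRows {c : ℕ} (h : Fin (r + 1) → ℂ)
    (F : Fin c → MvPolynomial (Fin (r + 1)) ℂ) (p : Fin (r + 1) → ℂ) :
    (fun i j => eval p (contactRows h F i j)) =
      (Fin.cons h fun i => gradient p (F i) : Fin (c + 1) → Fin (r + 1) → ℂ) := by
  funext i
  refine Fin.cases ?_ (fun i => ?_) i
  · funext j
    simp [contactRows]
  · funext j
    simp [contactRows]

/-- Homogeneous equations of `X`, in families indexed by `Fin c`. -/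
def IsEquations {c : ℕ} (X : Set (PSpace r)) (F : Fin c → MvPolynomial (Fin (r + 1)) ℂ) : Prop :=
  ∀ i, F i ∈ coneIdeal X ∧ ∃ d : ℕ, (F i).IsHomogeneous d

theorem exists_equations_linearIndependent {X : Set (PSpace r)} {P : PSpace r} {c : ℕ}
    (hc : Module.finrank ℂ (conormalSpace X P) = c) :
    ∃ F : Fin c → MvPolynomial (Fin (r + 1)) ℂ, IsEquations X F ∧
      LinearIndependent ℂ (fun i => gradient P.rep (F i)) ∧
      Submodule.span ℂ (Set.range fun i => gradient P.rep (F i)) = conormalSpace X P := by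
  subst hc
  obtain ⟨w, hw, hspan, hli⟩ := Submodule.exists_fun_fin_finrank_span_eq ℂ
    {w | ∃ f ∈ coneIdeal X, (∃ d : ℕ, f.IsHomogeneous d) ∧ gradient P.rep f = w}
  choose F hF hd hFw using hw
  obtain rfl : (fun i => gradient P.rep (F i)) = w := funext hFw
  exact ⟨F, fun i => ⟨hF i, hd i⟩, hli, hspan⟩

/-- Membership in a `c`-dimensional space spanned by gradients means that adjoining `h` to any `c`
gradients never gives rank `c + 1`. -/
theorem mem_conormalSpace_iff_minor {X : Set (PSpace r)} {Q : PSpace r} {c : ℕ}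
    (hc : Module.finrank ℂ (conormalSpace X Q) = c) (h : Fin (r + 1) → ℂ) :
    h ∈ conormalSpace X Q ↔ ∀ F : Fin c → MvPolynomial (Fin (r + 1)) ℂ, IsEquations X F →
      ∀ B, eval Q.rep (minor (contactRows h F) B) = 0 := by
  constructor
  · intro hh F hF B
    rw [eval_minor, eval_contactRows]
    by_contra hdet
    have hli := linearIndependent_of_det_mul_ne_zero hdet
    have hmem : ∀ i, (Fin.cons h fun i => gradient Q.rep (F i) : Fin (c + 1) → Fin (r + 1) → ℂ) i ∈
        conormalSpace X Q := by
      intro i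
      refine Fin.cases ?_ (fun i => ?_) i
      · exact hh
      · exact gradient_mem_conormalSpace (hF i).1 Q
    have hli' : LinearIndependent ℂ (fun i => (⟨_, hmem i⟩ : conormalSpace X Q)) :=
      LinearIndependent.of_comp (conormalSpace X Q).subtype hli
    have := hli'.fintype_card_le_finrank
    rw [hc, Fintype.card_fin] at this
    omega
  · intro hB
    obtain ⟨F, hF, hli, hspan⟩ := exists_equations_linearIndependent hc
    by_contra hh
    rw [← hspan] at hh
    obtain ⟨B, hdet⟩ := exists_det_mul_ne_zero (linearIndependent_finCons.2 ⟨hli, hh⟩)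
    apply hdet
    rw [← hB F hF B, eval_minor, eval_contactRows]

theorem exists_isHomogeneous_minor_contactRows {X : Set (PSpace r)} {c : ℕ}
    (h : Fin (r + 1) → ℂ) {F : Fin c → MvPolynomial (Fin (r + 1)) ℂ} (hF : IsEquations X F)
    (B : Matrix (Fin (r + 1)) (Fin (c + 1)) ℂ) :
    ∃ d : ℕ, (minor (contactRows h F) B).IsHomogeneous d := by
  choose _ d hd using hF
  -- Truncated subtraction is harmless: when `d i = 0` the derivative is zero.
  refine ⟨_, isHomogeneous_minor B (d := Fin.cons 0 fun i => d i - 1) fun i j => ?_⟩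
  refine Fin.cases ?_ (fun i => ?_) i
  · simpa [contactRows] using isHomogeneous_C _ _
  · simpa [contactRows] using (hd i).pderiv

theorem mem_smoothLocus_iff {X : Set (PSpace r)} {m : ℕ} (hm : topologicalKrullDim X = m)
    {Q : PSpace r} :
    Q ∈ smoothLocus X ↔ Q ∈ X ∧ Module.finrank ℂ (tangentSpace X Q) = m + 1 := by
  rw [smoothLocus, Set.mem_ofPred_eq, hm]
  norm_cast

/-- Around a smooth point all points of `X` are smooth. -/
theorem exists_isHomogeneous_ne_zero_smooth {X : Set (PSpace r)} {m : ℕ} (hX : IsClosed X)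
    (hirr : IsIrreducible X) (hm : topologicalKrullDim X = m) {P : PSpace r}
    (hP : P ∈ smoothLocus X) :
    ∃ (δ : MvPolynomial (Fin (r + 1)) ℂ) (d : ℕ), δ.IsHomogeneous d ∧ eval P.rep δ ≠ 0 ∧
      ∀ Q ∈ X, eval Q.rep δ ≠ 0 → Q ∈ smoothLocus X := by
  rw [mem_smoothLocus_iff hm] at hP
  obtain ⟨F, hF, hli, -⟩ := exists_equations_linearIndependent (X := X) (P := P) rfl
  obtain ⟨B, hB⟩ := exists_det_mul_ne_zero hli
  choose hFX d hd using hF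
  refine ⟨minor (fun i j => pderiv j (F i)) B, _,
    isHomogeneous_minor B (d := fun i => d i - 1) fun i j => (hd i).pderiv, ?_, ?_⟩
  · rw [eval_minor]
    exact hB
  · intro Q hQ hδ
    rw [eval_minor] at hδ
    have hliQ : LinearIndependent ℂ (fun i => gradient Q.rep (F i)) :=
      linearIndependent_of_det_mul_ne_zero hδ
    have hli' : LinearIndependent ℂ
        (fun i => (⟨_, gradient_mem_conormalSpace (hFX i) Q⟩ : conormalSpace X Q)) :=
      LinearIndependent.of_comp (conormalSpace X Q).subtype hliQ
    have h1 := hli'.fintype_card_le_finrank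
    rw [Fintype.card_fin] at h1
    have h2 := finrank_conormalSpace_add_finrank_tangentSpace X P
    have h3 := finrank_conormalSpace_add_finrank_tangentSpace X Q
    -- `δ` bounds the tangent dimension at `Q` from above by that at `P`; this is the opposite
    -- bound.
    have h4 := finrank_tangentSpace_ge hX hirr hQ
    rw [hm] at h4
    have h5 : m + 1 ≤ Module.finrank ℂ (tangentSpace X Q) := by exact_mod_cast h4
    rw [mem_smoothLocus_iff hm]
    exact ⟨hQ, by omega⟩

/-- The hyperplane with equation `h` is tangent to `X` along a positive dimensional irreducible
closed subvariety through `P`. -/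
def HasContactThrough (X : Set (PSpace r)) (P : PSpace r) (h : Fin (r + 1) → ℂ) : Prop :=
  ∃ Z : Set (PSpace r), IsClosed Z ∧ IsIrreducible Z ∧ Z ⊆ X ∧ P ∈ Z ∧
    0 < topologicalKrullDim Z ∧
    ∀ Q ∈ Z, Q ∈ smoothLocus X → ∀ v ∈ tangentSpace X Q, h ⬝ᵥ v = 0

attribute [local instance] MvPolynomial.gradedAlgebra

/-- In a pencil of hyperplanes tangent at the smooth point `P`, positive dimensional contact
through `P` for infinitely many members implies the same for the given member `h`. -/
theorem hasContactThrough_of_infinite {X : Set (PSpace r)} {m : ℕ} (hX : IsClosed X)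
    (hirr : IsIrreducible X) (hm : topologicalKrullDim X = m) {P : PSpace r}
    (hP : P ∈ smoothLocus X) {h h' : Fin (r + 1) → ℂ}
    (hh : ∀ v ∈ tangentSpace X P, h ⬝ᵥ v = 0) (hh' : ∀ v ∈ tangentSpace X P, h' ⬝ᵥ v = 0)
    {T : Set ℂ} (hT : T.Infinite) (hcontact : ∀ t ∈ T, HasContactThrough X P (h + t • h')) :
    HasContactThrough X P h := by
  obtain ⟨δ, e, hδe, hδP, hδ⟩ := exists_isHomogeneous_ne_zero_smooth hX hirr hm hP
  have hdimP := ((mem_smoothLocus_iff hm).1 hP).2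
  set c := Module.finrank ℂ (conormalSpace X P) with hc
  have hcQ : ∀ Q ∈ smoothLocus X, Module.finrank ℂ (conormalSpace X Q) = c := by
    intro Q hQ
    have h1 := ((mem_smoothLocus_iff hm).1 hQ).2
    have h2 := finrank_conormalSpace_add_finrank_tangentSpace X Q
    have h3 := finrank_conormalSpace_add_finrank_tangentSpace X P
    omega
  have hPprime : (coneIdeal {P}).IsPrime := isPrime_coneIdeal isIrreducible_singleton
  have hPX : P ∈ X := ((mem_smoothLocus_iff hm).1 hP).1
  let S := MvPolynomial (Fin (r + 1)) ℂ
  -- Equations of the contact loci of the whole pencil, with `Polynomial.X` as the pencil parameter.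
  let gens : Set (Polynomial S) := {f | ∃ g ∈ coneIdeal X, f = Polynomial.C g} ∪
    {f | ∃ F : Fin c → S, IsEquations X F ∧ ∃ B, f = Polynomial.C (minor (contactRows h F) B) +
      Polynomial.X * Polynomial.C (minor (contactRows h' F) B)}
  have hminorP : ∀ u : Fin (r + 1) → ℂ, (∀ v ∈ tangentSpace X P, u ⬝ᵥ v = 0) →
      ∀ F : Fin c → S, IsEquations X F → ∀ B, minor (contactRows u F) B ∈ coneIdeal {P} := by
    intro u hu F hF B
    obtain ⟨d, hd⟩ := exists_isHomogeneous_minor_contactRows u hF B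
    rw [mem_coneIdeal_of_isHomogeneous hd]
    rintro _ rfl
    exact (mem_conormalSpace_iff_minor (hcQ _ hP) u).1 (mem_conormalSpace_iff.2 hu) F hF B
  have hJ : Ideal.span gens ≤ (coneIdeal {P}).map Polynomial.C := by
    rw [Ideal.span_le]
    rintro f (⟨g, hg, rfl⟩ | ⟨F, hF, B, rfl⟩)
    · exact Ideal.mem_map_of_mem _ (coneIdeal_anti (Set.singleton_subset_iff.2 hPX) hg)
    · exact Ideal.add_mem _ (Ideal.mem_map_of_mem _ (hminorP h hh F hF B))
        (Ideal.mul_mem_left _ _ (Ideal.mem_map_of_mem _ (hminorP h' hh' F hF B)))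
  obtain ⟨q, hq, hqP, hqJ⟩ := exists_prime_lt_of_infinite (coneIdeal {P}) (Ideal.span gens) hJ T hT
    (by
      intro t ht
      obtain ⟨Z, hZc, hZi, hZX, hPZ, hZdim, hZ⟩ := hcontact t ht
      have hZprime := isPrime_coneIdeal hZi
      refine ⟨coneIdeal Z, hZprime, coneIdeal_lt_of_topologicalKrullDim_pos hPZ hZdim, ?_⟩
      suffices hle : Ideal.span gens ≤
          (coneIdeal Z).comap (Polynomial.evalRingHom (algebraMap ℂ S t)) from
        fun f hf => hle hf
      rw [Ideal.span_le]
      rintro f (⟨g, hg, rfl⟩ | ⟨F, hF, B, rfl⟩)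
      · simpa using coneIdeal_anti hZX hg
      · have hev : Polynomial.evalRingHom (algebraMap ℂ S t)
            (Polynomial.C (minor (contactRows h F) B) +
              Polynomial.X * Polynomial.C (minor (contactRows h' F) B)) =
            minor (contactRows (h + t • h') F) B := by
          rw [minor_contactRows_add_smul]
          simp [S, algebraMap_eq]
          ring
        change Polynomial.evalRingHom (algebraMap ℂ S t) _ ∈ coneIdeal Z
        rw [hev]
        -- Tangency is known only at smooth points, so the minor is first multiplied by `δ`, which
        -- is then cancelled by primality.
        have hδZ : δ ∉ coneIdeal Z := fun hmem => hδP (eval_rep_of_mem_coneIdeal hmem hPZ)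
        obtain ⟨d, hd⟩ := exists_isHomogeneous_minor_contactRows (h + t • h') hF B
        refine (hZprime.mem_or_mem ?_).resolve_left hδZ
        rw [mem_coneIdeal_of_isHomogeneous (hδe.mul hd)]
        intro Q hQ
        rw [map_mul]
        by_cases hδQ : eval Q.rep δ = 0
        · rw [hδQ, zero_mul]
        · have hQs := hδ Q (hZX hQ) hδQ
          rw [(mem_conormalSpace_iff_minor (hcQ Q hQs) _).1
            (mem_conormalSpace_iff.2 (hZ Q hQ hQs)) F hF B, mul_zero])
  -- `q` need not be homogeneous; its homogeneous core is still prime and keeps all the homogeneous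
  -- equations of the fibre over `0`.
  have hcore_prime : (q.homogeneousCore (homogeneousSubmodule (Fin (r + 1)) ℂ)).toIdeal.IsPrime :=
    hq.homogeneousCore
  have hcore : ∀ f ∈ q, (∃ d : ℕ, f.IsHomogeneous d) →
      f ∈ (q.homogeneousCore (homogeneousSubmodule (Fin (r + 1)) ℂ)).toIdeal := by
    rintro f hf ⟨d, hd⟩
    exact Ideal.mem_homogeneousCore_of_homogeneous_of_mem ⟨d, hd⟩ hf
  obtain ⟨Z, hZc, hZi, hPZ, hZdim, hZ⟩ := exists_irreducible_of_prime_lt (P := P)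
    (lt_of_le_of_lt (Ideal.toIdeal_homogeneousCore_le _ q) hqP)
    (q.homogeneousCore (homogeneousSubmodule (Fin (r + 1)) ℂ)).isHomogeneous
  refine ⟨Z, hZc, hZi, fun Q hQ => ?_, hPZ, hZdim, fun Q hQ hQs => ?_⟩
  · rw [mem_iff_of_isClosed hX]
    intro f hf hd
    refine hZ Q hQ f (hcore f ?_ hd) hd
    simpa using hqJ (Polynomial.C f) (Ideal.subset_span (Or.inl ⟨f, hf, rfl⟩))
  · rw [← mem_conormalSpace_iff, mem_conormalSpace_iff_minor (hcQ Q hQs)]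
    intro F hF B
    have hd := exists_isHomogeneous_minor_contactRows h hF B
    refine hZ Q hQ _ (hcore _ ?_ hd) hd
    simpa using hqJ _ (Ideal.subset_span (Or.inr ⟨F, hF, B, rfl⟩))

end Contact

/-! ### From general to arbitrary tangent hyperplanes, and the induction on `k`. -/

section WeaklyDefective

open MvPolynomial

variable {r : ℕ}

theorem le_hyperplane_mk_iff {W : Submodule ℂ (Fin (r + 1) → ℂ)} {h : Fin (r + 1) → ℂ}
    (h0 : h ≠ 0) :
    W ≤ hyperplane (Projectivization.mk ℂ h h0) ↔ ∀ v ∈ W, h ⬝ᵥ v = 0 := by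
  obtain ⟨a, ha⟩ := Projectivization.exists_smul_eq_mk_rep ℂ h h0
  refine forall₂_congr fun v _ => ?_
  change (Projectivization.mk ℂ h h0).rep ⬝ᵥ v = 0 ↔ _
  rw [← ha, Units.smul_def, smul_dotProduct, smul_eq_mul, mul_eq_zero]
  simp

theorem le_hyperplane_iff {W : Submodule ℂ (Fin (r + 1) → ℂ)} {h : PSpace r} :
    W ≤ hyperplane h ↔ ∀ v ∈ W, h.rep ⬝ᵥ v = 0 := Iff.rfl

/-- An open set of hyperplanes contains infinitely many members of a pencil that meets it. -/
theorem infinite_pencil_mem {V : Set (PSpace r)} (hV : IsOpen V) (h₀ : PSpace r) {h₁ : PSpace r}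
    (h₁V : h₁ ∈ V) :
    {t : ℂ | ∃ h0 : h₀.rep + t • (h₁.rep - h₀.rep) ≠ 0,
      Projectivization.mk ℂ _ h0 ∈ V}.Infinite := by
  obtain ⟨S, hS, hVS⟩ := isClosed_iff_mem_algebraicSets.1 hV.isClosed_compl
  have hmem : ∀ h, h ∈ V ↔ ∃ f ∈ S, eval h.rep f ≠ 0 := by
    intro h
    rw [← not_iff_not, ← Set.mem_compl_iff, hVS]
    simp [zeroSet]
  obtain ⟨f, hf, hf₁⟩ := (hmem h₁).1 h₁V
  obtain ⟨d, hd⟩ := hS f hf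
  obtain ⟨j, hj⟩ := exists_rep_ne_zero h₀
  let line : Fin (r + 1) → Polynomial ℂ := fun i =>
    Polynomial.C (h₀.rep i) + Polynomial.X * Polynomial.C (h₁.rep i - h₀.rep i)
  let p : Polynomial ℂ := aeval line f
  have hline : ∀ t i, (line i).eval t = (h₀.rep + t • (h₁.rep - h₀.rep)) i := by
    intro t i
    simp [line]
  have hp : ∀ t, p.eval t = eval (h₀.rep + t • (h₁.rep - h₀.rep)) f := by
    intro t
    have h1 : (Polynomial.aeval t).comp (aeval line) =
        aeval (h₀.rep + t • (h₁.rep - h₀.rep)) := by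
      apply MvPolynomial.algHom_ext
      intro i
      rw [AlgHom.comp_apply, aeval_X, aeval_X, ← hline, Polynomial.coe_aeval_eq_eval]
    exact DFunLike.congr_fun h1 f
  have hp0 : p ≠ 0 := by
    intro h
    apply hf₁
    have := hp 1
    rw [h, Polynomial.eval_zero] at this
    rw [this]
    congr 2
    simp
  have hl0 : line j ≠ 0 := by
    intro h
    apply hj
    have := hline 0 j
    rw [h, Polynomial.eval_zero] at this
    simpa using this.symm
  -- `p` is nonzero by its value at `t = 1`, the member `h₁`; the factor `line j` excludes
  -- parameters where the coordinate vector vanishes.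
  have hfin : {t | (p * line j).IsRoot t}.Finite :=
    Polynomial.finite_setOfPred_isRoot (mul_ne_zero hp0 hl0)
  refine hfin.infinite_compl.mono fun t ht => ?_
  simp only [Set.mem_compl_iff, Set.mem_ofPred_eq, Polynomial.IsRoot.def, Polynomial.eval_mul,
    mul_eq_zero, not_or] at ht
  have h0 : h₀.rep + t • (h₁.rep - h₀.rep) ≠ 0 := by
    intro h
    apply ht.2
    rw [hline, h, Pi.zero_apply]
  refine ⟨h0, (hmem _).2 ⟨f, hf, ?_⟩⟩
  obtain ⟨a, ha⟩ := Projectivization.exists_smul_eq_mk_rep ℂ _ h0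
  rw [← ha, Units.smul_def, eval_smul_of_isHomogeneous hd, ← hp]
  exact mul_ne_zero (pow_ne_zero _ a.ne_zero) ht.1

/-- If the general hyperplane tangent at the smooth points `P i` has positive dimensional contact,
then so does every hyperplane tangent at these points. -/
theorem hasPositiveDimContact_of_open {X : Set (PSpace r)} {m n : ℕ} (hX : IsClosed X)
    (hirr : IsIrreducible X) (hm : topologicalKrullDim X = m) {P : Fin n → PSpace r}
    (hP : ∀ i, P i ∈ smoothLocus X) {V : Set (PSpace r)} (hV : IsOpen V)
    (hne : ∃ h ∈ V, tangentSpan X P ≤ hyperplane h)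
    (hcontact : ∀ h ∈ V, tangentSpan X P ≤ hyperplane h → HasPositiveDimContact X P h)
    {h₀ : PSpace r} (h₀P : tangentSpan X P ≤ hyperplane h₀) : HasPositiveDimContact X P h₀ := by
  obtain ⟨h₁, h₁V, h₁P⟩ := hne
  rw [le_hyperplane_iff] at h₀P h₁P
  set u := h₁.rep - h₀.rep with hu
  have huP : ∀ v ∈ tangentSpan X P, u ⬝ᵥ v = 0 := by
    intro v hv
    rw [hu, sub_dotProduct, h₁P v hv, h₀P v hv, sub_zero]
  have hinf := infinite_pencil_mem hV h₀ h₁V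
  have hsub : {t : ℂ | ∃ h0 : h₀.rep + t • (h₁.rep - h₀.rep) ≠ 0,
      Projectivization.mk ℂ _ h0 ∈ V} ⊆
      ⋃ i, {t : ℂ | HasContactThrough X (P i) (h₀.rep + t • u)} := by
    rintro t ⟨h0, htV⟩
    obtain ⟨Z, hZc, hZi, hZX, ⟨i, hi⟩, hZdim, hZ⟩ := hcontact _ htV (by
      rw [le_hyperplane_mk_iff]
      intro v hv
      rw [add_dotProduct, smul_dotProduct, h₀P v hv, huP v hv]
      simp)
    rw [Set.mem_iUnion]
    exact ⟨i, Z, hZc, hZi, hZX, hi, hZdim, fun Q hQ hQs =>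
      (le_hyperplane_mk_iff h0).1 (hZ Q hQ hQs)⟩
  -- Pigeonhole: the contact point may vary with `t`, but there are finitely many `P i`.
  have hex : ∃ i, {t : ℂ | HasContactThrough X (P i) (h₀.rep + t • u)}.Infinite := by
    by_contra! hc
    exact hinf ((Set.finite_iUnion hc).subset hsub)
  obtain ⟨i, hi⟩ := hex
  have hle : tangentSpace X (P i) ≤ tangentSpan X P := le_iSup (fun i => tangentSpace X (P i)) i
  obtain ⟨Z, hZc, hZi, hZX, hPZ, hZdim, hZ⟩ := hasContactThrough_of_infinite hX hirr hm (hP i)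
    (fun v hv => h₀P v (hle hv)) (fun v hv => huP v (hle hv)) hi fun t ht => ht
  exact ⟨Z, hZc, hZi, hZX, ⟨i, hPZ⟩, hZdim, hZ⟩

theorem isZariskiOpen_preimage_castSucc {n : ℕ} {U : Set (Fin n → PSpace r)}
    (hU : IsZariskiOpen U) :
    IsZariskiOpen {P : Fin (n + 1) → PSpace r | (fun i => P i.castSucc) ∈ U} := by
  obtain ⟨S, hS, rfl⟩ := hU
  let φ : Fin n × Fin (r + 1) → Fin (n + 1) × Fin (r + 1) := fun ij => (ij.1.castSucc, ij.2)
  refine ⟨rename φ '' S, ?_, ?_⟩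
  · rintro _ ⟨f, hf, rfl⟩
    obtain ⟨d, hd⟩ := hS f hf
    refine ⟨Fin.snoc d 0, fun {u} hu => ?_⟩
    obtain ⟨v, rfl, hv⟩ := coeff_rename_ne_zero _ _ _ hu
    have hdv := hd hv
    rw [Finsupp.weight_apply] at hdv ⊢
    rw [Finsupp.sum_mapDomain_index (by simp) (by intros; rw [add_smul])]
    funext i
    refine Fin.lastCases ?_ (fun i => ?_) i
    · simp [Finsupp.sum, Finset.sum_apply, φ]
    · have := congrFun hdv i
      simp only [Finsupp.sum, Finset.sum_apply, φ, Pi.single_apply, Pi.smul_apply, Fin.snoc_castSucc,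
        Fin.castSucc_inj] at this ⊢
      exact this
  · ext P
    simp only [Set.mem_ofPred_eq, Set.exists_mem_image, eval_rename]
    rfl

theorem finrank_iSup_le_sum {K V ι : Type*} [Field K] [AddCommGroup V] [Module K V]
    [FiniteDimensional K V] [Fintype ι] (W : ι → Submodule K V) :
    Module.finrank K (⨆ i, W i : Submodule K V) ≤ ∑ i, Module.finrank K (W i) := by
  classical
  rw [← Finset.sup_univ_eq_iSup]
  induction (Finset.univ : Finset ι) using Finset.induction_on with
  | empty => simp
  | insert i s hi ih =>
    rw [Finset.sup_insert, Finset.sum_insert hi]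
    exact (Submodule.finrank_add_le_finrank_add_finrank _ _).trans (by gcongr)

theorem exists_tangentSpan_le_hyperplane {X : Set (PSpace r)} {m n : ℕ}
    (hm : topologicalKrullDim X = m) {P : Fin n → PSpace r} (hP : ∀ i, P i ∈ smoothLocus X)
    (hn : n * (m + 1) < r + 1) : ∃ h, tangentSpan X P ≤ hyperplane h := by
  have hdim : Module.finrank ℂ (tangentSpan X P) ≤ n * (m + 1) := by
    have h1 : Module.finrank ℂ (tangentSpan X P) ≤
        ∑ i, Module.finrank ℂ (tangentSpace X (P i)) :=
      finrank_iSup_le_sum _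
    refine h1.trans (le_of_eq ?_)
    rw [Finset.sum_congr rfl fun i _ => ((mem_smoothLocus_iff hm).1 (hP i)).2]
    simp
  have hlt : tangentSpan X P < ⊤ := by
    rw [lt_top_iff_ne_top]
    intro h
    rw [h, finrank_top, Module.finrank_fin_fun] at hdim
    omega
  obtain ⟨φ, hφ, hle⟩ := Submodule.exists_le_ker_of_lt_top _ hlt
  let w := (dotProductEquiv ℂ (Fin (r + 1))).symm φ
  have hw : ∀ v, w ⬝ᵥ v = φ v := fun v =>
    DFunLike.congr_fun ((dotProductEquiv ℂ (Fin (r + 1))).apply_symm_apply φ) v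
  have hw0 : w ≠ 0 := by
    simpa [w] using hφ
  refine ⟨Projectivization.mk ℂ w hw0, (le_hyperplane_mk_iff hw0).2 fun v hv => ?_⟩
  rw [hw]
  exact hle hv

theorem isWeaklyDefective_succ {X : Set (PSpace r)} {m k : ℕ} (hX : IsNondegenerateVariety X m)
    (hr : (k + 1) * m + m + (k + 1) < r) (hk : IsWeaklyDefective X k) :
    IsWeaklyDefective X (k + 1) := by
  obtain ⟨U, hU, ⟨P₀, hP₀U, hP₀⟩, hcontact⟩ := hk
  -- The open set leaves the last point free, and tuples need not be distinct, so repeating `P₀ 0`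
  -- shows nonemptiness.
  refine ⟨_, isZariskiOpen_preimage_castSucc hU, ⟨Fin.snoc P₀ (P₀ 0), ?_, ?_⟩, ?_⟩
  · simpa using hP₀U
  · refine Fin.lastCases ?_ fun i => ?_
    · simpa using hP₀ 0
    · simpa using hP₀ i
  · intro P hPU hP
    have hP' : ∀ i : Fin (k + 1), P i.castSucc ∈ smoothLocus X := fun i => hP _
    obtain ⟨V, hV, hne, hVc⟩ := hcontact _ hPU hP'
    -- By semicontinuity no genericity of the hyperplane is needed.
    refine ⟨Set.univ, isOpen_univ, ?_, fun h _ hh => ?_⟩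
    -- The bound `hr` says exactly that `(k + 2) * (m + 1) < r + 1`.
    · obtain ⟨h, hh⟩ := exists_tangentSpan_le_hyperplane hX.dim_eq hP (by nlinarith)
      exact ⟨h, Set.mem_univ _, hh⟩
    · have hle : tangentSpan X (fun i : Fin (k + 1) => P i.castSucc) ≤ tangentSpan X P :=
        iSup_le fun i => le_iSup (fun i => tangentSpace X (P i)) i.castSucc
      obtain ⟨Z, hZc, hZi, hZX, ⟨i, hi⟩, hZ⟩ := hasPositiveDimContact_of_open hX.isClosed
        hX.isIrreducible hX.dim_eq hP' hV hne hVc (hle.trans hh)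
      exact ⟨Z, hZc, hZi, hZX, ⟨i.castSucc, hi⟩, hZ⟩

theorem isWeaklyDefective_of_le {X : Set (PSpace r)} {m j k : ℕ} (hX : IsNondegenerateVariety X m)
    (hjk : j ≤ k) (hr : k * m + m + k < r) (hj : IsWeaklyDefective X j) :
    IsWeaklyDefective X k := by
  induction k, hjk using Nat.le_induction with
  | base => exact hj
  | succ k _ ih => exact isWeaklyDefective_succ hX hr (ih (by nlinarith))

end WeaklyDefective

end WeakDefect

theorem mainTheorem5 (r m k : ℕ) (X : Set (WeakDefect.PSpace r))
    (hX : WeakDefect.IsNondegenerateVariety X m) (hk : 1 ≤ k)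
    (hr : k * m + m + k < r)
    (hnot : ¬ WeakDefect.IsWeaklyDefective X k) :
    ¬ WeakDefect.IsWeaklyDefective X (k - 1) ∧
      ∀ j ≤ k, ¬ WeakDefect.IsWeaklyDefective X j := by
  have key : ∀ j ≤ k, ¬ WeakDefect.IsWeaklyDefective X j := fun j hj h =>
    hnot (WeakDefect.isWeaklyDefective_of_le hX hj hr h)
  exact ⟨key (k - 1) (Nat.sub_le k 1), key⟩
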